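/- Let $n\ge 1$, let $S_k$ denote the set of $k$-element subsets of $\mathbb{Z}_+=\{0,1,2,\dots\}$, and let $(\nu_B)_{B\in S_{n-1}}$ be a family of probability measures on $\mathbb{Z}_+$ with $\nu_B(B)=0$ for every $B\in S_{n-1}$. The juggler's exclusion process (JEP) generated by $(\nu_B)$ is the discrete-time Markov process in $S_n$ with transition matrix $$P(A,B)=\begin{cases}1,&\text{if } 0\notin A,\ B=A-1,\\ \nu_{A^*-1}(y),&\text{if } 0\in A,\ B=(A^*-1)\cup\{y\},\\ 0,&\text{otherwise,}\end{cases}$$ where $A^*=A\setminus\{\min A\}$ and $A-1=\{a-1: a\in A\}$. A probability measure $\pi$ on $S_n$ is an equilibrium distribution of the JEP if $\pi P=\pi$. Suppose that $(\nu_B)$ is uniformly integrable, i.e. $\sup_{B\in S_{n-1}}\sum_{x>K}x\,\nu_B(x)\to 0$ as $K\to\infty$, and that $\nu_B(\min(B^c))>0$ for all $B\in S_{n-1}$, where $B^c=\mathbb{Z}_+\setminus B$. Then the JEP has a unique equilibrium distribution $\pi$, and for every initial configuration $A\in S_n$ the distribution at time $t$ of the process started from $A$, that is $P^t(A,\cdot)$,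 converges to $\pi$ in total variation: $\sup_{E\subseteq S_n}|P^t(A,E)-\pi(E)|\to 0$ as $t\to\infty$. -/

import Mathlib

open scoped ENNReal

namespace Juggling

/-- `Config n` is the countable space of `n`-element subsets of `{0, 1, 2, …}`. -/
abbrev Config (n : ℕ) : Type := {A : Finset ℕ // A.card = n}

/-- The set obtained by shifting all elements of `A` down by one position
(only used for sets that do not contain `0`). -/
def shiftDown (A : Finset ℕ) : Finset ℕ := A.image (fun x => x - 1)

theorem Config.nonempty {n : ℕ} (A : Config (n + 1)) : A.1.Nonempty := by
  rw [← Finset.card_pos, A.2]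
  exact Nat.succ_pos n

/-- The set obtained by deleting the smallest element of `A`. -/
def deleteMin {n : ℕ} (A : Config (n + 1)) : Finset ℕ := A.1.erase (A.1.min' A.nonempty)

theorem deleteMin_pos {n : ℕ} (A : Config (n + 1)) {x : ℕ} (hx : x ∈ deleteMin A) : 0 < x := by
  rw [deleteMin, Finset.mem_erase] at hx
  have h := A.1.min'_le x hx.2
  omega

theorem card_shiftDown_deleteMin {n : ℕ} (A : Config (n + 1)) :
    (shiftDown (deleteMin A)).card = n := by
  rw [shiftDown, Finset.card_image_of_injOn]
  · rw [deleteMin, Finset.card_erase_of_mem (A.1.min'_mem A.nonempty), A.2]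
    omega
  · intro x hx y hy hxy
    have h1 := deleteMin_pos A hx
    have h2 := deleteMin_pos A hy
    simp only at hxy
    omega

/-- The `n`-element set obtained from `A` by deleting its smallest element and shifting the
other `n` elements down by one position. -/
def others {n : ℕ} (A : Config (n + 1)) : Config n :=
  ⟨shiftDown (deleteMin A), card_shiftDown_deleteMin A⟩

/-- The jump distributions do not charge occupied sites. -/
def Noncolliding {n : ℕ} (ν : Config n → PMF ℕ) : Prop :=
  ∀ B : Config n, ∑ y ∈ B.1, ν B y = 0

/-- The lowest unoccupied site is always hit with positive probability. -/
def AperiodicityCondition {n : ℕ} (ν : Config n → PMF ℕ) : Prop :=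
  ∀ B : Config n, 0 < ν B (sInf ((B.1 : Set ℕ)ᶜ))

/-- Uniform integrability: `sup_B ∑_{x > K} x ν_B(x) → 0` as `K → ∞`. -/
def UniformlyIntegrable {n : ℕ} (ν : Config n → PMF ℕ) : Prop :=
  Filter.Tendsto
    (fun K : ℕ => ⨆ B : Config n, ∑' x : ℕ, if K < x then (x : ℝ≥0∞) * ν B x else 0)
    Filter.atTop (nhds 0)

/-- The transition matrix of the juggler's exclusion process with `n + 1` particles generated
by the family `ν`. When `0 ∈ A`, at most one `y` contributes to the sum, because `B` has one
element more than `others A`; thus the entry is `ν_{others A}(y)` if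
`B = others A ∪ {y}` for some `y`, and `0` otherwise. -/
noncomputable def transition {n : ℕ} (ν : Config n → PMF ℕ) (A B : Config (n + 1)) : ℝ≥0∞ :=
  if 0 ∈ A.1 then
    ∑' y : ℕ, if B.1 = (others A).1 ∪ {y} then ν (others A) y else 0
  else
    if B.1 = shiftDown A.1 then 1 else 0

/-- The `t`-step transition probabilities (the matrix power `P ^ t`). -/
noncomputable def stepTransition {n : ℕ} (ν : Config n → PMF ℕ) :
    ℕ → Config (n + 1) → Config (n + 1) → ℝ≥0∞
  | 0, A, B => if A = B then 1 else 0
  | t + 1, A, B => ∑' C : Config (n + 1), stepTransition ν t A C * transition ν C B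

/-- `X` is a juggler's exclusion process generated by `ν`: a discrete-time Markov process
in `Config (n + 1)` with transition matrix `transition ν`. The Markov property is written in
multiplied-out form for each finite trajectory `a 0, …, a (t + 1)`. -/
structure IsJEP {n : ℕ} (ν : Config n → PMF ℕ) {Ω : Type*} [MeasurableSpace Ω]
    (μ : MeasureTheory.Measure Ω) (X : ℕ → Ω → Config (n + 1)) : Prop where
  measurable : ∀ (t : ℕ) (A : Config (n + 1)), MeasurableSet {ω | X t ω = A}
  markov : ∀ (t : ℕ) (a : ℕ → Config (n + 1)),
    μ {ω | ∀ s ≤ t + 1, X s ω = a s} =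
      μ {ω | ∀ s ≤ t, X s ω = a s} * transition ν (a t) (a (t + 1))

/-- `π` is an equilibrium distribution: it satisfies the balance equation `π P = π`. -/
def IsEquilibrium {n : ℕ} (ν : Config n → PMF ℕ) (π : PMF (Config (n + 1))) : Prop :=
  ∀ B : Config (n + 1), ∑' A : Config (n + 1), π A * transition ν A B = π B

/-- The total variation distance `sup_E |p(E) - q(E)|` of two probability mass functions. The
absolute difference of two extended nonnegative numbers is written as the larger of
the two truncated differences. -/
noncomputable def tvDist {S : Type*} (p q : S → ℝ≥0∞) : ℝ≥0∞ :=
  ⨆ E : Set S, max ((∑' x : E, p x) - ∑' x : E, q x) ((∑' x : E, q x) - ∑' x : E, p x)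

end Juggling

/-!
The argument is a Foster–Lyapunov drift estimate followed by a merging argument in `ℓ¹`, carried
out for a general countable chain with a reference state `g`.

*Drift* (`Juggling.exists_drift`). Let `M` be the height of the highest particle. In one step `M`
goes down by one unless a ball is thrown above it, so `(M - K)₊` changes on average by at most
`-1 + 𝔼 (y - K)₊` when `M > K`. Uniform integrability makes the last term at most `1 / 2` for a
suitable `K`, whatever the configuration is; and `{M ≤ K}` is finite.

*Accessibility* (`Juggling.exists_transition_pos_heightSum_lt`). Throwing every ball to the lowest
free site has positive probability, and it decreases the sum of the heights until the ground
state `g = {0, …, n}` is reached, where the chain may stay.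

*Domination* (`CountableChain.push_iterate_single_le`). By these two facts, the expected hitting
time of `g` is finite from every state
(`CountableChain.tsum_pull_killed_iterate_one_ne_top`). Hence the Green functions of the chain
killed at `g` are finite measures, and the laws of the chain at all times, from a given initial
state, lie below the sum of two of them.

*Merging* (`CountableChain.exists_uniform_excess_le`). If `p` and `q` lie below a finite measure
`D`, all but `ε` of the mass of the positive and of the negative part of `p - q` sits on a finite
set, each point of which sends a fraction `δ` to `g` in `N` steps. There it cancels, so
`‖p - q‖` drops by a fixed fraction as long as it is not of order `ε`. The speed depends on `D`
only. Applied to a trajectory of laws and its time shifts this gives a Cauchy sequence, whose limit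
is stationary (`CountableChain.exists_stationary`); applied to a trajectory and a stationary law it
gives convergence, and applied to two stationary laws it gives uniqueness.
-/

namespace CountableChain

/-! ### Actions of a transition matrix -/

/-- The action `p ↦ p P` of a transition matrix on (mass functions of) measures. -/
noncomputable def push {S : Type*} (P : S → S → ℝ≥0∞) (p : S → ℝ≥0∞) : S → ℝ≥0∞ :=
  fun y => ∑' x, p x * P x y

/-- The action `f ↦ P f` of a transition matrix on nonnegative functions. -/
noncomputable def pull {S : Type*} (P : S → S → ℝ≥0∞) (f : S → ℝ≥0∞) : S → ℝ≥0∞ :=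
  fun x => ∑' y, P x y * f y

theorem tsum_push_mul {S : Type*} (P : S → S → ℝ≥0∞) (p f : S → ℝ≥0∞) :
    ∑' y, push P p y * f y = ∑' x, p x * pull P f x := by
  simp only [push, pull, ← ENNReal.tsum_mul_left, ← ENNReal.tsum_mul_right, mul_assoc]
  exact ENNReal.tsum_comm

theorem tsum_push_iterate_mul {S : Type*} (P : S → S → ℝ≥0∞) (t : ℕ) (p f : S → ℝ≥0∞) :
    ∑' y, (push P)^[t] p y * f y = ∑' x, p x * (pull P)^[t] f x := by
  induction t generalizing p with
  | zero => rfl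
  | succ t ih =>
    rw [Function.iterate_succ_apply, ih, tsum_push_mul, Function.iterate_succ_apply']

theorem push_iterate_apply {S : Type*} [DecidableEq S] (P : S → S → ℝ≥0∞) (t : ℕ)
    (p : S → ℝ≥0∞) (y : S) :
    (push P)^[t] p y = ∑' x, p x * (pull P)^[t] (Pi.single y 1) x := by
  rw [← tsum_push_iterate_mul, tsum_eq_single y]
  · simp
  · intro z hz
    simp [hz]

theorem push_add {S : Type*} (P : S → S → ℝ≥0∞) (p q : S → ℝ≥0∞) :
    push P (p + q) = push P p + push P q := by
  ext y
  simp [push, add_mul, ENNReal.tsum_add]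

theorem push_iterate_add {S : Type*} (P : S → S → ℝ≥0∞) (t : ℕ) (p q : S → ℝ≥0∞) :
    (push P)^[t] (p + q) = (push P)^[t] p + (push P)^[t] q := by
  induction t generalizing p q with
  | zero => rfl
  | succ t ih => simp only [Function.iterate_succ_apply, push_add, ih]

theorem push_mono {S : Type*} (P : S → S → ℝ≥0∞) {p q : S → ℝ≥0∞} (h : p ≤ q) :
    push P p ≤ push P q :=
  fun _ => ENNReal.tsum_le_tsum fun x => mul_le_mul_left (h x) _

theorem pull_mono {S : Type*} (P : S → S → ℝ≥0∞) {f f' : S → ℝ≥0∞} (h : f ≤ f') :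
    pull P f ≤ pull P f' :=
  fun _ => ENNReal.tsum_le_tsum fun y => mul_le_mul_right (h y) _

theorem pull_add {S : Type*} (P : S → S → ℝ≥0∞) (f f' : S → ℝ≥0∞) :
    pull P (f + f') = pull P f + pull P f' := by
  ext y
  simp [pull, mul_add, ENNReal.tsum_add]

theorem pull_const_mul {S : Type*} (P : S → S → ℝ≥0∞) (c : ℝ≥0∞) (f : S → ℝ≥0∞) :
    pull P (fun x => c * f x) = fun x => c * pull P f x := by
  ext x
  simp only [pull, ← ENNReal.tsum_mul_left]
  exact tsum_congr fun y => mul_left_comm _ _ _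

theorem pull_iterate_mono {S : Type*} (P : S → S → ℝ≥0∞) (t : ℕ) :
    Monotone ((pull P)^[t]) :=
  Monotone.iterate (fun _ _ h => pull_mono P h) t

theorem pull_iterate_add {S : Type*} (P : S → S → ℝ≥0∞) (t : ℕ) (f f' : S → ℝ≥0∞) :
    (pull P)^[t] (f + f') = (pull P)^[t] f + (pull P)^[t] f' := by
  induction t generalizing f f' with
  | zero => rfl
  | succ t ih => simp only [Function.iterate_succ_apply, pull_add, ih]

theorem pull_iterate_const_mul {S : Type*} (P : S → S → ℝ≥0∞) (t : ℕ) (c : ℝ≥0∞)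
    (f : S → ℝ≥0∞) :
    (pull P)^[t] (fun x => c * f x) = fun x => c * (pull P)^[t] f x := by
  induction t generalizing f with
  | zero => rfl
  | succ t ih => simp only [Function.iterate_succ_apply, pull_const_mul, ih]

theorem pull_one {S : Type*} {P : S → S → ℝ≥0∞} (hP : ∀ x, ∑' y, P x y = 1) :
    pull P 1 = 1 := by
  ext x
  simp [pull, hP]

theorem tsum_push_iterate {S : Type*} {P : S → S → ℝ≥0∞} (hP : ∀ x, ∑' y, P x y = 1)
    (t : ℕ) (p : S → ℝ≥0∞) : ∑' y, (push P)^[t] p y = ∑' x, p x := by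
  have h := tsum_push_iterate_mul P t p 1
  rw [Function.iterate_fixed (pull_one hP)] at h
  simpa using h

/-! ### Accessibility of a reference state -/

/-- The strictly decreasing rank leads any state to `g` with positive probability, and the loop
at `g` lets the chain wait there. -/
theorem pull_iterate_single_pos {S : Type*} [DecidableEq S] {P : S → S → ℝ≥0∞} {g : S}
    (hg : 0 < P g g) {rank : S → ℕ} (hrank : ∀ x, x ≠ g → ∃ y, 0 < P x y ∧ rank y < rank x)
    (N : ℕ) (x : S) (hx : rank x ≤ N) : 0 < (pull P)^[N] (Pi.single g 1) x := by
  have step : ∀ (N : ℕ) (x y : S), 0 < P x y → 0 < (pull P)^[N] (Pi.single g 1) y →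
      0 < (pull P)^[N + 1] (Pi.single g 1) x := by
    intro N x y h1 h2
    rw [Function.iterate_succ_apply']
    exact (ENNReal.mul_pos h1.ne' h2.ne').trans_le
      (ENNReal.le_tsum (f := fun y => P x y * (pull P)^[N] (Pi.single g 1) y) y)
  have loop : ∀ N, 0 < (pull P)^[N] (Pi.single g 1) g := by
    intro N
    induction N with
    | zero => simp
    | succ N ih => exact step N g g hg ih
  induction N generalizing x with
  | zero =>
    by_cases h : x = g
    · rw [h]
      exact loop 0
    · obtain ⟨y, -, hy⟩ := hrank x h
      omega
  | succ N ih =>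
    by_cases h : x = g
    · rw [h]
      exact loop _
    · obtain ⟨y, h1, h2⟩ := hrank x h
      exact step N x y h1 (ih y (by omega))

theorem exists_uniform_minorization {S : Type*} [DecidableEq S] {P : S → S → ℝ≥0∞} {g : S}
    (hg : 0 < P g g) {rank : S → ℕ} (hrank : ∀ x, x ≠ g → ∃ y, 0 < P x y ∧ rank y < rank x)
    (F : Finset S) :
    ∃ (N : ℕ) (δ : ℝ≥0∞), 0 < N ∧ 0 < δ ∧ δ ≤ 1 ∧
      ∀ x ∈ F, δ ≤ (pull P)^[N] (Pi.single g 1) x := by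
  refine ⟨F.sup rank + 1, min 1 (F.inf ((pull P)^[F.sup rank + 1] (Pi.single g 1))),
    Nat.succ_pos _, lt_min one_pos ?_, min_le_left _ _, fun x hx =>
      (min_le_right _ _).trans (Finset.inf_le hx)⟩
  rw [Finset.lt_inf_iff (by simp)]
  intro x hx
  exact pull_iterate_single_pos hg hrank _ x ((Finset.le_sup hx).trans (Nat.le_succ _))

/-! ### The chain killed at the reference state -/

/-- The transition matrix of the chain that is killed when it jumps to `g`: the total mass of its
`t`-th power in row `x` is the probability that the chain started from `x` avoids `g` at the
times `1, …, t`. -/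
def killed {S : Type*} [DecidableEq S] (P : S → S → ℝ≥0∞) (g : S) : S → S → ℝ≥0∞ :=
  fun x y => if y = g then 0 else P x y

theorem killed_le {S : Type*} [DecidableEq S] (P : S → S → ℝ≥0∞) (g x y : S) :
    killed P g x y ≤ P x y := by
  unfold killed
  split_ifs <;> simp

theorem pull_killed_le {S : Type*} [DecidableEq S] (P : S → S → ℝ≥0∞) (g : S)
    (f : S → ℝ≥0∞) : pull (killed P g) f ≤ pull P f :=
  fun x => ENNReal.tsum_le_tsum fun y => mul_le_mul_left (killed_le P g x y) _

theorem pull_eq_pull_killed_add {S : Type*} [DecidableEq S] (P : S → S → ℝ≥0∞) (g : S)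
    (f : S → ℝ≥0∞) (x : S) : pull P f x = pull (killed P g) f x + P x g * f g := by
  have h : P x g * f g = ∑' y, if y = g then P x y * f y else 0 := by simp
  rw [h, pull, pull, ← ENNReal.tsum_add]
  refine tsum_congr fun y => ?_
  by_cases hy : y = g <;> simp [killed, hy]

/-- Avoiding `g` up to time `N` and sitting in `g` at time `N` are exclusive events. -/
theorem pull_killed_iterate_one_add_le {S : Type*} [DecidableEq S] {P : S → S → ℝ≥0∞}
    (hP : ∀ x, ∑' y, P x y = 1) (g : S) (N : ℕ) (x : S) (hx : 0 < N ∨ x ≠ g) :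
    (pull (killed P g))^[N] 1 x + (pull P)^[N] (Pi.single g 1) x ≤ 1 := by
  induction N generalizing x with
  | zero =>
    have : x ≠ g := by simpa using hx
    simp [this]
  | succ N ih =>
    have hle : (pull P)^[N] (Pi.single g 1) g ≤ 1 := by
      have h := pull_iterate_mono P N (a := Pi.single g 1) (b := 1) (by
        intro y; by_cases hy : y = g <;> simp [hy]) g
      rwa [Function.iterate_fixed (pull_one hP)] at h
    rw [Function.iterate_succ_apply', Function.iterate_succ_apply',
      pull_eq_pull_killed_add P g ((pull P)^[N] _), ← add_assoc, ← Pi.add_apply, ← pull_add]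
    calc _ ≤ pull (killed P g) 1 x + P x g * (1 : S → ℝ≥0∞) g := by
          refine add_le_add (ENNReal.tsum_le_tsum fun y => ?_) (mul_le_mul_right hle _)
          by_cases hy : y = g
          · simp [killed, hy]
          · exact mul_le_mul_right (ih y (Or.inr hy)) _
      _ = 1 := by rw [← pull_eq_pull_killed_add, pull_one hP]; rfl

/-- Foster's criterion: under a drift condition towards a finite set from which `g` is accessible,
the expected hitting time of `g`, written as the sum of the tail probabilities, is finite. -/
theorem tsum_pull_killed_iterate_one_ne_top {S : Type*} [DecidableEq S] {P : S → S → ℝ≥0∞}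
    (hP : ∀ x, ∑' y, P x y = 1) {g : S} (C : Set S) {N : ℕ} (hN : 0 < N) {δ : ℝ≥0∞}
    (hδ : 0 < δ) (hδ1 : δ ≤ 1) (hC : ∀ x ∈ C, δ ≤ (pull P)^[N] (Pi.single g 1) x)
    (W : S → ℝ≥0∞) (hW : ∀ x, W x ≠ ∞) {b : ℝ≥0∞} (hb : b ≠ ∞)
    (hdrift : ∀ x, pull P W x + 1 ≤ W x + b * C.indicator 1 x) (x : S) :
    ∑' t, (pull (killed P g))^[t] 1 x ≠ ∞ := by
  set Q := killed P g with hQ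
  set c : ℕ → ℝ≥0∞ := fun t => (pull Q)^[t] 1 x with hc
  set d : ℕ → ℝ≥0∞ := fun t => (pull Q)^[t] (C.indicator 1) x with hd
  have hc1 : ∀ t, c t ≤ 1 := by
    intro t
    have hle : ∀ t, (pull Q)^[t] 1 ≤ (1 : S → ℝ≥0∞) := by
      intro t
      induction t with
      | zero => rfl
      | succ t ih =>
        rw [Function.iterate_succ_apply']
        exact ((pull_mono Q ih).trans (pull_killed_le P g 1)).trans (pull_one hP).le
    exact hle t x
  have hexcl : (fun x => δ * C.indicator 1 x) + (pull Q)^[N] 1 ≤ (1 : S → ℝ≥0∞) := by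
    intro y
    have h := pull_killed_iterate_one_add_le hP g N y (Or.inl hN)
    by_cases hy : y ∈ C
    · simp only [Pi.add_apply, Set.indicator_of_mem hy, Pi.one_apply, mul_one]
      rw [add_comm]
      exact (add_le_add_right (hC y hy) _).trans h
    · simp only [Pi.add_apply, Set.indicator_of_notMem hy, mul_zero, zero_add]
      exact le_self_add.trans h
  have hstep : ∀ t, δ * d t + c (t + N) ≤ c t := by
    intro t
    have h := pull_iterate_mono Q t hexcl x
    rw [pull_iterate_add, pull_iterate_const_mul] at h
    rwa [← Function.iterate_add_apply] at h
  -- summing `hstep` telescopes: only the first `N` terms survive, whatever `L` is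
  have hdsum : ∀ L, δ * ∑ t ∈ Finset.range L, d t ≤ N := by
    intro L
    have h1 : δ * ∑ t ∈ Finset.range L, d t + ∑ t ∈ Finset.range L, c (t + N)
        ≤ ∑ t ∈ Finset.range L, c t := by
      rw [Finset.mul_sum, ← Finset.sum_add_distrib]
      exact Finset.sum_le_sum fun t _ => hstep t
    have h2 : ∑ t ∈ Finset.range L, c t
        ≤ (∑ t ∈ Finset.range N, c t) + ∑ t ∈ Finset.range L, c (t + N) := by
      rw [show ∑ t ∈ Finset.range L, c (t + N) = ∑ t ∈ Finset.range L, c (N + t) by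
        simp only [add_comm], ← Finset.sum_range_add]
      exact Finset.sum_le_sum_of_subset (Finset.range_mono (by omega))
    have h3 : ∑ t ∈ Finset.range N, c t ≤ N := by
      simpa using Finset.sum_le_card_nsmul (Finset.range N) c 1 fun t _ => hc1 t
    have hfin : ∑ t ∈ Finset.range L, c (t + N) ≠ ∞ :=
      ENNReal.sum_ne_top.2 fun t _ => ne_top_of_le_ne_top ENNReal.one_ne_top (hc1 _)
    exact (ENNReal.add_le_add_iff_right hfin).1 ((h1.trans h2).trans (by gcongr))
  have hdrift' : ∀ L, (∑ t ∈ Finset.range L, c t) + (pull Q)^[L] W x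
      ≤ W x + b * ∑ t ∈ Finset.range L, d t := by
    intro L
    induction L with
    | zero => simp
    | succ L ih =>
      have h0 : pull Q W + 1 ≤ W + fun x => b * C.indicator 1 x := fun y =>
        (add_le_add_left (pull_killed_le P g W y) 1).trans (hdrift y)
      have h := pull_iterate_mono Q L h0 x
      rw [pull_iterate_add, pull_iterate_add, pull_iterate_const_mul,
        ← Function.iterate_succ_apply] at h
      rw [Finset.sum_range_succ, Finset.sum_range_succ, mul_add, ← add_assoc]
      calc _ = (∑ t ∈ Finset.range L, c t) + ((pull Q)^[L + 1] W x + c L) := by ring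
        _ ≤ (∑ t ∈ Finset.range L, c t) + ((pull Q)^[L] W x + b * d L) :=
          add_le_add_right h _
        _ ≤ _ := by
          rw [← add_assoc]
          exact add_le_add_left ih _
  have hbound : ∑' t, c t ≤ W x + b * (N / δ) := by
    rw [ENNReal.tsum_eq_iSup_nat]
    refine iSup_le fun L => (le_self_add.trans (hdrift' L)).trans ?_
    gcongr
    rw [ENNReal.le_div_iff_mul_le (Or.inl hδ.ne')
      (Or.inl (ne_top_of_le_ne_top ENNReal.one_ne_top hδ1)), mul_comm]
    exact hdsum L
  refine ne_top_of_le_ne_top ?_ hbound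
  exact ENNReal.add_ne_top.2 ⟨hW x, ENNReal.mul_ne_top hb
    (ENNReal.div_ne_top (ENNReal.natCast_ne_top N) hδ.ne')⟩

/-- The Green function of the chain killed at `g`, as a measure: the expected numbers of visits
to the states before the first return to `g`. -/
noncomputable def green {S : Type*} [DecidableEq S] (P : S → S → ℝ≥0∞) (g x : S) :
    S → ℝ≥0∞ :=
  fun y => ∑' t, (push (killed P g))^[t] (Pi.single x 1) y

theorem tsum_green {S : Type*} [DecidableEq S] (P : S → S → ℝ≥0∞) (g x : S) :
    ∑' y, green P g x y = ∑' t, (pull (killed P g))^[t] 1 x := by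
  unfold green
  rw [ENNReal.tsum_comm]
  refine tsum_congr fun t => ?_
  have h := tsum_push_iterate_mul (killed P g) t (Pi.single x 1) 1
  rw [tsum_eq_single (f := fun z => (Pi.single x 1 : S → ℝ≥0∞) z * _) x
    (by intro z hz; simp [hz])] at h
  simpa using h

theorem push_killed_green_le {S : Type*} [DecidableEq S] (P : S → S → ℝ≥0∞) (g x : S) :
    push (killed P g) (green P g x) ≤ green P g x := by
  intro y
  simp only [push, green, ← ENNReal.tsum_mul_right]
  rw [ENNReal.tsum_comm]
  refine le_trans (le_of_eq (tsum_congr fun t => ?_))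
    (ENNReal.tsum_comp_le_tsum_of_injective (add_left_injective 1) _)
  rw [Function.iterate_succ_apply']
  rfl

theorem one_le_green_self {S : Type*} [DecidableEq S] (P : S → S → ℝ≥0∞) (g x : S) :
    1 ≤ green P g x x := by
  have h := ENNReal.le_tsum (f := fun t => (push (killed P g))^[t] (Pi.single x 1) x) 0
  simpa [green] using h

/-- The laws of the chain at all times lie below one fixed measure: the last excursion from `g`
(or the initial piece of the trajectory) accounts for the position at time `t`. -/
theorem push_iterate_single_le {S : Type*} [DecidableEq S] {P : S → S → ℝ≥0∞}
    (hP : ∀ x, ∑' y, P x y = 1) (g x : S) (t : ℕ) :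
    (push P)^[t] (Pi.single x 1) ≤ green P g x + green P g g := by
  induction t with
  | zero =>
    intro y
    by_cases hy : y = x
    · subst hy
      simpa using (one_le_green_self P g y).trans le_self_add
    · simp [hy]
  | succ t ih =>
    intro y
    by_cases hy : y = g
    · subst hy
      calc _ ≤ ∑' z, (push P)^[t + 1] (Pi.single x 1) z := ENNReal.le_tsum y
        _ = 1 := by
          rw [tsum_push_iterate hP, tsum_eq_single x (by intro z hz; simp [hz])]
          simp
        _ ≤ _ := (one_le_green_self P y y).trans le_add_self
    · rw [Function.iterate_succ_apply']
      calc _ = push (killed P g) ((push P)^[t] (Pi.single x 1)) y := by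
            simp [push, killed, hy]
        _ ≤ push (killed P g) (green P g x + green P g g) y := push_mono _ ih y
        _ ≤ _ := by
          rw [push_add]
          exact add_le_add (push_killed_green_le P g x y) (push_killed_green_le P g g y)

/-! ### Merging of two trajectories of laws -/

/-- The total mass of the positive part of `p - q`. For probability measures this is the total
variation distance. -/
noncomputable def excess {S : Type*} (p q : S → ℝ≥0∞) : ℝ≥0∞ := ∑' x, (p x - q x)

theorem excess_comm {S : Type*} {p q : S → ℝ≥0∞} (hp : ∑' x, p x = 1) (hq : ∑' x, q x = 1) :
    excess p q = excess q p := by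
  have h : ∑' x, p x + excess q p = ∑' x, q x + excess p q := by
    rw [excess, excess, ← ENNReal.tsum_add, ← ENNReal.tsum_add]
    exact tsum_congr fun x => by rw [add_tsub_eq_max, add_tsub_eq_max, max_comm]
  rw [hp, hq] at h
  exact ((ENNReal.add_right_inj ENNReal.one_ne_top).1 h).symm

/-- The positive and the negative part of `p - q` both send mass to `g`, where it cancels. -/
theorem excess_push_iterate_add_min_le {S : Type*} {P : S → S → ℝ≥0∞}
    (hP : ∀ x, ∑' y, P x y = 1) {p q : S → ℝ≥0∞} (hq : ∑' x, q x = 1)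
    (g : S) (N : ℕ) :
    excess ((push P)^[N] p) ((push P)^[N] q)
      + min ((push P)^[N] (p - q) g) ((push P)^[N] (q - p) g) ≤ excess p q := by
  classical
  set r := (push P)^[N] (p - q)
  set r' := (push P)^[N] (q - p)
  have hsum : ∀ x, (push P)^[N] p x + r' x = (push P)^[N] q x + r x := by
    intro x
    have h : p + (q - p) = q + (p - q) := by
      ext y
      simp only [Pi.add_apply, Pi.sub_apply]
      rw [add_tsub_eq_max, add_tsub_eq_max, max_comm]
    have := congrFun (congrArg (push P)^[N] h) x
    rwa [push_iterate_add, push_iterate_add] at this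
  have hr' : ∀ x, r' x ≠ ∞ := by
    intro x
    refine ne_top_of_le_ne_top ENNReal.one_ne_top ?_
    calc r' x ≤ ∑' y, r' y := ENNReal.le_tsum x
      _ = ∑' y, (q - p) y := tsum_push_iterate hP N _
      _ ≤ ∑' y, q y := ENNReal.tsum_le_tsum fun y => tsub_le_self
      _ = 1 := hq
  have hpt : ∀ x, ((push P)^[N] p x - (push P)^[N] q x) ≤ r x - r' x := by
    intro x
    rw [tsub_le_iff_right]
    refine (ENNReal.add_le_add_iff_right (hr' x)).1 ?_
    rw [hsum x, add_right_comm, add_comm]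
    exact add_le_add_left le_tsub_add _
  calc _ ≤ (∑' x, (r x - r' x)) + ∑' x, (if x = g then min (r x) (r' x) else 0) := by
        refine add_le_add (ENNReal.tsum_le_tsum hpt) (le_of_eq ?_)
        simp
    _ ≤ ∑' x, r x := by
      rw [← ENNReal.tsum_add]
      refine ENNReal.tsum_le_tsum fun x => ?_
      refine le_trans (add_le_add_right ?_ _) (tsub_add_min (a := r x) (b := r' x)).le
      split_ifs
      · rfl
      · exact zero_le
    _ = excess p q := tsum_push_iterate hP N _

theorem excess_push_le {S : Type*} {P : S → S → ℝ≥0∞}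
    (hP : ∀ x, ∑' y, P x y = 1) {p q : S → ℝ≥0∞} (hq : ∑' x, q x = 1) :
    excess (push P p) (push P q) ≤ excess p q := by
  by_cases hS : Nonempty S
  · exact le_self_add.trans (excess_push_iterate_add_min_le hP hq hS.some 1)
  · have := not_nonempty_iff.1 hS
    simp [excess]

/-- A measure below `D` puts all but `ε` of its mass on `F`, and each point of `F` sends a
fraction `δ` to `g`. -/
theorem mul_sub_le_push_iterate {S : Type*} [DecidableEq S] {P : S → S → ℝ≥0∞} {g : S}
    {F : Finset S} {N : ℕ} {δ : ℝ≥0∞}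
    (hF : ∀ x ∈ F, δ ≤ (pull P)^[N] (Pi.single g 1) x) {D r : S → ℝ≥0∞} {ε : ℝ≥0∞}
    (hD : ∑' x : {x // x ∉ F}, D x ≤ ε) (hr : r ≤ D) :
    δ * (∑' x, r x - ε) ≤ (push P)^[N] r g := by
  have h1 : ∑' x, r x - ε ≤ ∑ x ∈ F, r x := by
    have h := ENNReal.summable.tsum_add_tsum_compl (f := r) (s := {x | x ∈ F})
      ENNReal.summable
    rw [tsub_le_iff_right, ← h, ← Finset.tsum_subtype F r]
    exact add_le_add_right
      ((ENNReal.tsum_le_tsum fun x : {x // x ∉ F} => hr x.1).trans hD) _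
  calc _ ≤ δ * ∑ x ∈ F, r x := mul_le_mul_right h1 _
    _ ≤ ∑ x ∈ F, r x * (pull P)^[N] (Pi.single g 1) x := by
      rw [Finset.mul_sum]
      refine Finset.sum_le_sum fun x hx => ?_
      rw [mul_comm]
      exact mul_le_mul_right (hF x hx) _
    _ ≤ _ := by
      rw [push_iterate_apply]
      exact ENNReal.sum_le_tsum F

theorem exists_uniform_le_two_mul {δ ε : ℝ≥0∞} (hδ : 0 < δ) (hε : 0 < ε) (hε' : ε ≠ ∞) :
    ∃ L : ℕ, ∀ a : ℕ → ℝ≥0∞, a 0 ≤ 1 → (∀ k, a (k + 1) + δ * (a k - ε) ≤ a k) →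
      a L ≤ 2 * ε := by
  obtain ⟨L, hL⟩ := ENNReal.exists_nat_mul_gt (ENNReal.mul_pos hδ.ne' hε.ne').ne'
    ENNReal.one_ne_top
  refine ⟨L, fun a h0 ha => ?_⟩
  by_contra! hcon
  have hanti : Antitone a := antitone_nat_of_succ_le fun k => le_self_add.trans (ha k)
  have h : ∀ k ≤ L, a k + k * (δ * ε) ≤ 1 := by
    intro k
    induction k with
    | zero => simpa using h0
    | succ k ih =>
      intro hk
      have hk' : ε ≤ a k - ε := by
        refine ENNReal.le_sub_of_add_le_right hε' ?_
        rw [← two_mul]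
        exact hcon.le.trans (hanti (by omega))
      calc a (k + 1) + ((k + 1 : ℕ) : ℝ≥0∞) * (δ * ε)
          = (a (k + 1) + δ * ε) + k * (δ * ε) := by push_cast; ring
        _ ≤ a k + k * (δ * ε) := by
          gcongr
          exact (add_le_add_right (mul_le_mul_right hk' _) _).trans (ha k)
        _ ≤ 1 := ih (by omega)
  exact absurd (le_add_self.trans (h L le_rfl)) (not_le.2 hL)

/-- Two trajectories of laws below a common finite measure merge, at a speed that depends only on
that measure. -/
theorem exists_uniform_excess_le {S : Type*} [DecidableEq S] {P : S → S → ℝ≥0∞}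
    (hP : ∀ x, ∑' y, P x y = 1) {g : S} (hg : 0 < P g g) {rank : S → ℕ}
    (hrank : ∀ x, x ≠ g → ∃ y, 0 < P x y ∧ rank y < rank x) {D : S → ℝ≥0∞}
    (hD : ∑' x, D x ≠ ∞) {ε : ℝ≥0∞} (hε : 0 < ε) :
    ∃ T : ℕ, ∀ p q : S → ℝ≥0∞, ∑' x, p x = 1 → ∑' x, q x = 1 →
      (∀ t, (push P)^[t] p ≤ D) → (∀ t, (push P)^[t] q ≤ D) →
      ∀ t, T ≤ t → excess ((push P)^[t] p) ((push P)^[t] q) ≤ ε := by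
  obtain ⟨η, hη, hηtop, hηε⟩ : ∃ η : ℝ≥0∞, 0 < η ∧ η ≠ ∞ ∧ 2 * η ≤ ε := by
    refine ⟨min 1 (ε / 2), lt_min one_pos (ENNReal.half_pos hε.ne'),
      ne_top_of_le_ne_top ENNReal.one_ne_top (min_le_left _ _), ?_⟩
    calc 2 * min 1 (ε / 2) ≤ 2 * (ε / 2) := mul_le_mul_right (min_le_right _ _) _
      _ = ε := ENNReal.mul_div_cancel (by simp) (by simp)
  obtain ⟨F, hF⟩ : ∃ F : Finset S, ∑' x : {x // x ∉ F}, D x ≤ η :=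
    ((ENNReal.tendsto_tsum_compl_atTop_zero hD).eventually (ge_mem_nhds hη)).exists
  obtain ⟨N, δ, -, hδ, -, hmin⟩ := exists_uniform_minorization hg hrank F
  obtain ⟨L, hL⟩ := exists_uniform_le_two_mul hδ hη hηtop
  refine ⟨N * L, fun p q hp hq hpD hqD t ht => ?_⟩
  have hanti : Antitone fun t => excess ((push P)^[t] p) ((push P)^[t] q) := by
    refine antitone_nat_of_succ_le fun t => ?_
    rw [Function.iterate_succ_apply', Function.iterate_succ_apply']
    exact excess_push_le hP (by rw [tsum_push_iterate hP, hq])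
  refine (hanti ht).trans (le_trans ?_ hηε)
  refine hL (fun k => excess ((push P)^[N * k] p) ((push P)^[N * k] q)) ?_ fun k => ?_
  · calc _ ≤ ∑' x, p x := ENNReal.tsum_le_tsum fun x => tsub_le_self
      _ ≤ 1 := hp.le
  · set p' := (push P)^[N * k] p with hp'
    set q' := (push P)^[N * k] q with hq'
    have hp1 : ∑' x, p' x = 1 := by rw [hp', tsum_push_iterate hP, hp]
    have hq1 : ∑' x, q' x = 1 := by rw [hq', tsum_push_iterate hP, hq]
    have h := excess_push_iterate_add_min_le hP (p := p') hq1 g N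
    rw [show N * (k + 1) = N + N * k by ring, Function.iterate_add_apply,
      Function.iterate_add_apply]
    refine le_trans (add_le_add_right (le_min ?_ ?_) _) h
    · exact mul_sub_le_push_iterate hmin hF
        (r := p' - q') fun x => tsub_le_self.trans (hpD _ x)
    · rw [excess_comm hp1 hq1]
      exact mul_sub_le_push_iterate hmin hF
        (r := q' - p') fun x => tsub_le_self.trans (hqD _ x)

theorem tendsto_excess {S : Type*} [DecidableEq S] {P : S → S → ℝ≥0∞}
    (hP : ∀ x, ∑' y, P x y = 1) {g : S} (hg : 0 < P g g) {rank : S → ℕ}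
    (hrank : ∀ x, x ≠ g → ∃ y, 0 < P x y ∧ rank y < rank x) {p q D D' : S → ℝ≥0∞}
    (hp : ∑' x, p x = 1) (hq : ∑' x, q x = 1)
    (hD : ∑' x, D x ≠ ∞) (hD' : ∑' x, D' x ≠ ∞)
    (hpD : ∀ t, (push P)^[t] p ≤ D) (hqD : ∀ t, (push P)^[t] q ≤ D') :
    Filter.Tendsto (fun t => excess ((push P)^[t] p) ((push P)^[t] q))
      Filter.atTop (nhds 0) := by
  rw [ENNReal.tendsto_atTop_zero]
  intro ε hε
  obtain ⟨T, hT⟩ := exists_uniform_excess_le hP hg hrank (D := D + D') (by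
    simp only [Pi.add_apply, ENNReal.tsum_add]
    exact ENNReal.add_ne_top.2 ⟨hD, hD'⟩) hε
  exact ⟨T, hT p q hp hq (fun t x => (hpD t x).trans le_self_add)
    fun t x => (hqD t x).trans le_add_self⟩

/-! ### The stationary law -/

theorem tendsto_tsum_of_le {S : Type*} [Countable S] {u : ℕ → S → ℝ≥0∞} {v D : S → ℝ≥0∞}
    (hD : ∑' x, D x ≠ ∞) (hu : ∀ t, u t ≤ D)
    (hlim : ∀ x, Filter.Tendsto (fun t => u t x) Filter.atTop (nhds (v x))) :
    Filter.Tendsto (fun t => ∑' x, u t x) Filter.atTop (nhds (∑' x, v x)) := by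
  let _ : MeasurableSpace S := ⊤
  have : MeasurableSingletonClass S := ⟨fun _ => trivial⟩
  simp only [← MeasureTheory.lintegral_count] at hD ⊢
  exact MeasureTheory.tendsto_lintegral_of_dominated_convergence D
    (fun _ => measurable_from_top) (fun t => Filter.Eventually.of_forall (hu t)) hD
    (Filter.Eventually.of_forall hlim)

/-- A trajectory of laws below a finite measure is Cauchy, because it merges uniformly with its
own time shifts; its limit is stationary. -/
theorem exists_stationary {S : Type*} [Countable S] [DecidableEq S] {P : S → S → ℝ≥0∞}
    (hP : ∀ x, ∑' y, P x y = 1) {g : S} (hg : 0 < P g g) {rank : S → ℕ}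
    (hrank : ∀ x, x ≠ g → ∃ y, 0 < P x y ∧ rank y < rank x) {p D : S → ℝ≥0∞}
    (hp : ∑' x, p x = 1) (hD : ∑' x, D x ≠ ∞) (hpD : ∀ t, (push P)^[t] p ≤ D) :
    ∃ π : PMF S, push P π = π := by
  have hmass : ∀ t, ∑' x, (push P)^[t] p x = 1 := fun t => by rw [tsum_push_iterate hP, hp]
  have hle1 : ∀ t x, (push P)^[t] p x ≤ 1 := fun t x => hmass t ▸ ENNReal.le_tsum x
  have hne : ∀ t x, (push P)^[t] p x ≠ ∞ := fun t x =>
    ne_top_of_le_ne_top ENNReal.one_ne_top (hle1 t x)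
  have hcauchy : ∀ x, CauchySeq fun t => ((push P)^[t] p x).toReal := by
    intro x
    rw [Metric.cauchySeq_iff']
    intro ε hε
    obtain ⟨T, hT⟩ := exists_uniform_excess_le hP hg hrank hD
      (ENNReal.ofReal_pos.2 (half_pos hε))
    refine ⟨T, fun t ht => ?_⟩
    obtain ⟨s, rfl⟩ := Nat.exists_eq_add_of_le ht
    have hs : ∀ t, (push P)^[t] ((push P)^[s] p) ≤ D := fun t => by
      rw [← Function.iterate_add_apply]; exact hpD _
    have key : ∀ u v : S → ℝ≥0∞, excess u v ≤ ENNReal.ofReal (ε / 2) → u x ≠ ∞ → v x ≠ ∞ →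
        (u x).toReal - (v x).toReal ≤ ε / 2 := by
      intro u v huv hu hv
      have h1 : u x ≤ ENNReal.ofReal (ε / 2) + v x := by
        rw [← tsub_le_iff_right]
        exact (ENNReal.le_tsum (f := fun x => u x - v x) x).trans huv
      have h2 := ENNReal.toReal_mono (ENNReal.add_ne_top.2 ⟨ENNReal.ofReal_ne_top, hv⟩) h1
      rw [ENNReal.toReal_add ENNReal.ofReal_ne_top hv,
        ENNReal.toReal_ofReal (half_pos hε).le] at h2
      linarith
    have h1 := key _ _ (hT p _ hp (hmass s) hpD hs T le_rfl) (hne _ _)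
      (by rw [← Function.iterate_add_apply]; exact hne _ _)
    have h2 := key _ _ (hT _ p (hmass s) hp hs hpD T le_rfl)
      (by rw [← Function.iterate_add_apply]; exact hne _ _) (hne _ _)
    rw [← Function.iterate_add_apply] at h1 h2
    rw [Real.dist_eq, abs_lt]
    constructor <;> linarith
  choose l hl using fun x => cauchySeq_tendsto_of_complete (hcauchy x)
  have hlim : ∀ x, Filter.Tendsto (fun t => (push P)^[t] p x) Filter.atTop
      (nhds (ENNReal.ofReal (l x))) := by
    intro x
    have h := ENNReal.tendsto_ofReal (hl x)
    simpa only [ENNReal.ofReal_toReal (hne _ x)] using h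
  have hsum : ∑' x, ENNReal.ofReal (l x) = 1 := by
    refine tendsto_nhds_unique (tendsto_tsum_of_le hD hpD hlim) ?_
    simp only [hmass]
    exact tendsto_const_nhds
  refine ⟨⟨fun x => ENNReal.ofReal (l x), hsum ▸ ENNReal.summable.hasSum⟩, ?_⟩
  ext y
  have hP1 : ∀ x, P x y ≤ 1 := fun x => hP x ▸ ENNReal.le_tsum y
  have h1 : Filter.Tendsto (fun t => (push P)^[t + 1] p y) Filter.atTop
      (nhds (push P (fun x => ENNReal.ofReal (l x)) y)) := by
    simp only [Function.iterate_succ_apply']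
    refine tendsto_tsum_of_le hD (fun t x => ?_) fun x => ?_
    · exact (mul_le_of_le_one_right' (hP1 x)).trans (hpD t x)
    · exact ENNReal.Tendsto.mul_const (hlim x)
        (Or.inr (ne_top_of_le_ne_top ENNReal.one_ne_top (hP1 x)))
  exact tendsto_nhds_unique h1 ((Filter.tendsto_add_atTop_iff_nat 1).2 (hlim y))

/-- A Foster–Lyapunov drift condition towards a finite set, together with a state `g` that has a
loop and can be reached from everywhere, forces ergodicity. -/
theorem exists_unique_stationary_and_tendsto {S : Type*} [Countable S] [DecidableEq S]
    {P : S → S → ℝ≥0∞} (hP : ∀ x, ∑' y, P x y = 1) {g : S} (hg : 0 < P g g) {rank : S → ℕ}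
    (hrank : ∀ x, x ≠ g → ∃ y, 0 < P x y ∧ rank y < rank x) {C : Set S} (hC : C.Finite)
    {W : S → ℝ≥0∞} (hW : ∀ x, W x ≠ ∞) {b : ℝ≥0∞} (hb : b ≠ ∞)
    (hdrift : ∀ x, pull P W x + 1 ≤ W x + b * C.indicator 1 x) :
    ∃ π : PMF S, push P π = π ∧ (∀ π' : PMF S, push P π' = π' → π' = π) ∧
      ∀ x, Filter.Tendsto (fun t => excess ((push P)^[t] (Pi.single x 1)) π)
        Filter.atTop (nhds 0) := by
  obtain ⟨N, δ, hN, hδ, hδ1, hmin⟩ := exists_uniform_minorization hg hrank hC.toFinset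
  have hfin : ∀ x, ∑' y, (green P g x + green P g g) y ≠ ∞ := by
    intro x
    have h := tsum_pull_killed_iterate_one_ne_top hP C hN hδ hδ1
      (fun x hx => hmin x (hC.mem_toFinset.2 hx)) W hW hb hdrift
    simp only [Pi.add_apply, ENNReal.tsum_add, tsum_green]
    exact ENNReal.add_ne_top.2 ⟨h x, h g⟩
  have hone : ∀ x, ∑' y, (Pi.single x 1 : S → ℝ≥0∞) y = 1 := by
    intro x
    rw [tsum_eq_single x (by intro z hz; simp [hz])]
    simp
  obtain ⟨π, hπ⟩ := exists_stationary hP hg hrank (hone g) (hfin g)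
    (push_iterate_single_le hP g g)
  have hstat : ∀ π : PMF S, push P π = π → ∀ t, (push P)^[t] π = π := fun π hπ t =>
    Function.iterate_fixed hπ t
  have hπfin : ∀ π : PMF S, ∑' x, π x ≠ ∞ := fun π => π.tsum_coe ▸ ENNReal.one_ne_top
  refine ⟨π, hπ, fun π' hπ' => ?_, fun x => ?_⟩
  · have key : ∀ π π' : PMF S, push P π = π → push P π' = π' → ∀ x, π x ≤ π' x := by
      intro π π' hπ hπ' x
      have h := tendsto_excess hP hg hrank π.tsum_coe π'.tsum_coe (hπfin π) (hπfin π')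
        (fun t => (hstat π hπ t).le) (fun t => (hstat π' hπ' t).le)
      simp only [hstat π hπ, hstat π' hπ'] at h
      have h0 : excess π π' = 0 := tendsto_nhds_unique tendsto_const_nhds h
      exact tsub_eq_zero_iff_le.1 (ENNReal.tsum_eq_zero.1 h0 x)
    ext x
    exact le_antisymm (key π' π hπ' hπ x) (key π π' hπ hπ' x)
  · have h := tendsto_excess hP hg hrank (hone x) π.tsum_coe (hfin x) (hπfin π)
      (push_iterate_single_le hP g x) (fun t => (hstat π hπ t).le)
    simpa only [hstat π hπ] using h

end CountableChain

namespace Juggling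

/-! ### Geometry of the configurations -/

/-- The highest occupied site. -/
def maxHeight {n : ℕ} (A : Config n) : ℕ := A.1.sup id

/-- The sum of the heights of all particles. -/
def heightSum {n : ℕ} (A : Config n) : ℕ := ∑ x ∈ A.1, x

/-- The configuration `{0, …, n}`. -/
def ground (n : ℕ) : Config (n + 1) := ⟨Finset.range (n + 1), Finset.card_range _⟩

/-- The configuration with one particle added at a free site. -/
def addParticle {n : ℕ} (B : Config n) (y : ℕ) (hy : y ∉ B.1) : Config (n + 1) :=
  ⟨B.1 ∪ {y}, by rw [Finset.card_union_of_disjoint (by simpa using hy), B.2]; simp⟩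

/-- The configuration after a free fall by one step. -/
def fall {n : ℕ} (A : Config n) (hA : 0 ∉ A.1) : Config n :=
  ⟨shiftDown A.1, by
    rw [shiftDown, Finset.card_image_of_injOn, A.2]
    intro x hx y hy hxy
    have h1 : x ≠ 0 := fun h => hA (h ▸ hx)
    have h2 : y ≠ 0 := fun h => hA (h ▸ hy)
    simp only at hxy
    omega⟩

theorem sum_shiftDown_add_card {s : Finset ℕ} (hs : 0 ∉ s) :
    ∑ x ∈ shiftDown s, x + s.card = ∑ x ∈ s, x := by
  rw [shiftDown, Finset.sum_image, Finset.card_eq_sum_ones, ← Finset.sum_add_distrib]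
  · refine Finset.sum_congr rfl fun x hx => ?_
    have : x ≠ 0 := fun h => hs (h ▸ hx)
    omega
  · intro x hx y hy hxy
    have h1 : x ≠ 0 := fun h => hs (h ▸ hx)
    have h2 : y ≠ 0 := fun h => hs (h ▸ hy)
    simp only at hxy
    omega

theorem sup_shiftDown_le (s : Finset ℕ) : (shiftDown s).sup id ≤ s.sup id - 1 := by
  refine Finset.sup_le fun x hx => ?_
  obtain ⟨y, hy, rfl⟩ := Finset.mem_image.1 hx
  have : y ≤ s.sup id := Finset.le_sup (f := id) hy
  simp only [id]
  omega

theorem deleteMin_eq_erase_zero {n : ℕ} {A : Config (n + 1)} (hA : 0 ∈ A.1) :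
    deleteMin A = A.1.erase 0 := by
  have h : A.1.min' A.nonempty = 0 := Nat.le_zero.1 (A.1.min'_le 0 hA)
  rw [deleteMin, h]

theorem maxHeight_others_le {n : ℕ} (A : Config (n + 1)) :
    maxHeight (others A) ≤ maxHeight A - 1 :=
  (sup_shiftDown_le _).trans
    (Nat.sub_le_sub_right (Finset.sup_mono (Finset.erase_subset _ _)) 1)

theorem heightSum_others_add {n : ℕ} {A : Config (n + 1)} (hA : 0 ∈ A.1) :
    heightSum (others A) + n = heightSum A := by
  have h := sum_shiftDown_add_card (s := deleteMin A) (fun h => (deleteMin_pos A h).ne' rfl)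
  have hc : (deleteMin A).card = n := by
    rw [deleteMin_eq_erase_zero hA, Finset.card_erase_of_mem hA, A.2]
    rfl
  rw [hc] at h
  rw [heightSum, others, h, deleteMin_eq_erase_zero hA, heightSum]
  exact Finset.sum_erase A.1 (f := fun x => x) rfl

theorem heightSum_fall_add {n : ℕ} (A : Config n) (hA : 0 ∉ A.1) :
    heightSum (fall A hA) + n = heightSum A := by
  have h := sum_shiftDown_add_card hA
  rwa [A.2] at h

theorem heightSum_addParticle {n : ℕ} (B : Config n) (y : ℕ) (hy : y ∉ B.1) :
    heightSum (addParticle B y hy) = heightSum B + y := by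
  rw [heightSum, addParticle, Finset.sum_union (by simpa using hy)]
  simp [heightSum]

/-- The lowest free site. -/
noncomputable def lowestFree {n : ℕ} (B : Config n) : ℕ := sInf ((B.1 : Set ℕ)ᶜ)

theorem lowestFree_notMem {n : ℕ} (B : Config n) : lowestFree B ∉ B.1 := by
  have h : lowestFree B ∈ ((B.1 : Set ℕ)ᶜ) :=
    Nat.sInf_mem B.1.finite_toSet.infinite_compl.nonempty
  simpa using h

theorem range_lowestFree_subset {n : ℕ} (B : Config n) :
    Finset.range (lowestFree B) ⊆ B.1 := by
  intro x hx
  by_contra h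
  exact Nat.notMem_of_lt_sInf (Finset.mem_range.1 hx) (by simpa using h)

theorem lowestFree_le {n : ℕ} (B : Config n) : lowestFree B ≤ n := by
  simpa [B.2] using Finset.card_le_card (range_lowestFree_subset B)

theorem eq_range_of_lowestFree_eq {n : ℕ} {B : Config n} (h : lowestFree B = n) :
    B.1 = Finset.range n := by
  refine (Finset.eq_of_subset_of_card_le ?_ ?_).symm
  · simpa [h] using range_lowestFree_subset B
  · simp [B.2]

theorem others_ground (n : ℕ) : (others (ground n)).1 = Finset.range n := by
  have h0 : 0 ∈ (ground n).1 := by simp [ground]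
  change shiftDown (deleteMin (ground n)) = _
  rw [deleteMin_eq_erase_zero h0]
  ext x
  simp only [shiftDown, ground, Finset.mem_image, Finset.mem_erase, Finset.mem_range]
  constructor
  · rintro ⟨y, hy, rfl⟩
    omega
  · intro hx
    exact ⟨x + 1, by omega, by omega⟩

theorem eq_ground_of_others_eq_range {n : ℕ} {A : Config (n + 1)} (hA : 0 ∈ A.1)
    (h : (others A).1 = Finset.range n) : A = ground n := by
  refine Subtype.ext (Finset.eq_of_subset_of_card_le (fun x hx => ?_) ?_)
  · simp only [ground, Finset.mem_range]
    by_cases h0 : x = 0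
    · omega
    · have hx' : x - 1 ∈ (others A).1 := by
        refine Finset.mem_image.2 ⟨x, ?_, rfl⟩
        rw [deleteMin_eq_erase_zero hA]
        exact Finset.mem_erase.2 ⟨h0, hx⟩
      rw [h, Finset.mem_range] at hx'
      omega
  · rw [A.2, (ground n).2]

theorem finite_setOf_maxHeight_le (n K : ℕ) : {A : Config n | maxHeight A ≤ K}.Finite := by
  refine Set.Finite.of_finite_image (f := Subtype.val) ?_ Subtype.val_injective.injOn
  refine (Finset.range (K + 1)).powerset.finite_toSet.subset ?_
  rintro _ ⟨A, hA, rfl⟩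
  simp only [Finset.coe_powerset, Set.mem_preimage, Set.mem_powerset_iff, Finset.coe_subset]
  intro x hx
  have : x ≤ maxHeight A := Finset.le_sup (f := id) hx
  have hA' : maxHeight A ≤ K := hA
  exact Finset.mem_range.2 (by omega)

/-! ### The transition matrix -/

theorem transition_of_notMem {n : ℕ} (ν : Config n → PMF ℕ) {A : Config (n + 1)}
    (hA : 0 ∉ A.1) (B : Config (n + 1)) :
    transition ν A B = if B = fall A hA then 1 else 0 := by
  simp only [transition, hA, if_false, Subtype.ext_iff, fall]

theorem pull_transition_of_notMem {n : ℕ} (ν : Config n → PMF ℕ) {A : Config (n + 1)}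
    (hA : 0 ∉ A.1) (f : Config (n + 1) → ℝ≥0∞) :
    CountableChain.pull (transition ν) f A = f (fall A hA) := by
  rw [CountableChain.pull, tsum_eq_single (fall A hA)]
  · simp [transition_of_notMem ν hA]
  · intro B hB
    simp [transition_of_notMem ν hA, hB]

theorem apply_eq_zero_of_mem {n : ℕ} {ν : Config n → PMF ℕ} (hnc : Noncolliding ν)
    {B : Config n} {y : ℕ} (hy : y ∈ B.1) : ν B y = 0 :=
  Finset.sum_eq_zero_iff.1 (hnc B) y hy

theorem pull_transition_of_mem {n : ℕ} {ν : Config n → PMF ℕ} (hnc : Noncolliding ν)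
    {A : Config (n + 1)} (hA : 0 ∈ A.1) (f : Config (n + 1) → ℝ≥0∞) :
    CountableChain.pull (transition ν) f A =
      ∑' y, ν (others A) y * if hy : y ∈ (others A).1 then 0 else
        f (addParticle (others A) y hy) := by
  simp only [CountableChain.pull, transition, hA, if_true, ← ENNReal.tsum_mul_right]
  rw [ENNReal.tsum_comm]
  refine tsum_congr fun y => ?_
  by_cases hy : y ∈ (others A).1
  · simp [apply_eq_zero_of_mem hnc hy]
  · rw [tsum_eq_single (addParticle (others A) y hy)]
    · simp [hy, addParticle]
    · intro B hB
      have hB' : B.1 ≠ (others A).1 ∪ {y} := fun h => hB (Subtype.ext h)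
      rw [if_neg hB', zero_mul]

theorem tsum_transition {n : ℕ} {ν : Config n → PMF ℕ} (hnc : Noncolliding ν)
    (A : Config (n + 1)) : ∑' B, transition ν A B = 1 := by
  have h : ∑' B, transition ν A B = CountableChain.pull (transition ν) 1 A := by
    simp [CountableChain.pull]
  rw [h]
  by_cases hA : 0 ∈ A.1
  · rw [pull_transition_of_mem hnc hA, ← (ν (others A)).tsum_coe]
    refine tsum_congr fun y => ?_
    by_cases hy : y ∈ (others A).1
    · simp [apply_eq_zero_of_mem hnc hy]
    · simp [hy]
  · rw [pull_transition_of_notMem ν hA]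
    rfl

theorem transition_addParticle_lowestFree_pos {n : ℕ} {ν : Config n → PMF ℕ}
    (hap : AperiodicityCondition ν) {A : Config (n + 1)} (hA : 0 ∈ A.1) :
    0 < transition ν A (addParticle (others A) _ (lowestFree_notMem (others A))) := by
  simp only [transition, hA, if_true]
  refine (hap (others A)).trans_le (le_trans (le_of_eq ?_)
    (ENNReal.le_tsum (lowestFree (others A))))
  simp [addParticle, lowestFree]

theorem transition_ground_pos {n : ℕ} {ν : Config n → PMF ℕ} (hap : AperiodicityCondition ν) :
    0 < transition ν (ground n) (ground n) := by
  have h := transition_addParticle_lowestFree_pos hap (A := ground n) (by simp [ground])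
  have hO := others_ground n
  have hle := lowestFree_le (others (ground n))
  have hge : ¬ lowestFree (others (ground n)) < n := by
    have := lowestFree_notMem (others (ground n))
    rwa [hO, Finset.mem_range] at this
  have hB : addParticle (others (ground n)) _ (lowestFree_notMem (others (ground n))) =
      ground n := by
    refine Subtype.ext ?_
    change (others (ground n)).1 ∪ {lowestFree (others (ground n))} = Finset.range (n + 1)
    rw [hO, le_antisymm hle (not_lt.1 hge), Finset.range_add_one, Finset.union_comm]
    rfl
  rwa [hB] at h

/-- Throwing every ball to the lowest free site decreases the sum of the heights until the
ground state is reached. -/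
theorem exists_transition_pos_heightSum_lt {n : ℕ} {ν : Config n → PMF ℕ}
    (hap : AperiodicityCondition ν) (A : Config (n + 1)) (hg : A ≠ ground n) :
    ∃ B, 0 < transition ν A B ∧ heightSum B < heightSum A := by
  by_cases hA : 0 ∈ A.1
  · refine ⟨_, transition_addParticle_lowestFree_pos hap hA, ?_⟩
    rw [heightSum_addParticle, ← heightSum_others_add hA]
    have h1 := lowestFree_le (others A)
    have h2 : lowestFree (others A) ≠ n := fun h =>
      hg (eq_ground_of_others_eq_range hA (eq_range_of_lowestFree_eq h))
    omega
  · refine ⟨fall A hA, by simp [transition_of_notMem ν hA], ?_⟩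
    have := heightSum_fall_add A hA
    omega

/-! ### The drift condition -/

theorem exists_tsum_mul_sub_le {n : ℕ} {ν : Config n → PMF ℕ} (hui : UniformlyIntegrable ν) :
    ∃ K : ℕ, ∀ B, ∑' y, ν B y * (2 * ((y - K : ℕ) : ℝ≥0∞)) ≤ 1 := by
  obtain ⟨K, hK⟩ := (hui.eventually (ge_mem_nhds
    (ENNReal.inv_pos.2 (ENNReal.ofNat_ne_top (n := 2))))).exists
  refine ⟨K, fun B => ?_⟩
  calc _ ≤ ∑' y : ℕ, 2 * (if K < y then (y : ℝ≥0∞) * ν B y else 0) := by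
        refine ENNReal.tsum_le_tsum fun y => ?_
        split_ifs with h
        · rw [mul_left_comm, mul_comm (ν B y)]
          gcongr
          omega
        · rw [Nat.sub_eq_zero_of_le (not_lt.1 h)]
          simp
    _ = 2 * ∑' y : ℕ, (if K < y then (y : ℝ≥0∞) * ν B y else 0) := ENNReal.tsum_mul_left
    _ ≤ 2 * 2⁻¹ := mul_le_mul_right
      ((le_iSup (fun B => ∑' y : ℕ, if K < y then (y : ℝ≥0∞) * ν B y else 0) B).trans hK) _
    _ = 1 := ENNReal.mul_inv_cancel (by simp) (by simp)

theorem maxHeight_addParticle_sub_le {n : ℕ} (B : Config n) {y : ℕ} (hy : y ∉ B.1) (K : ℕ) :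
    maxHeight (addParticle B y hy) - K ≤ (maxHeight B - K) + (y - K) := by
  have h : maxHeight (addParticle B y hy) = max (maxHeight B) y := by
    simp [maxHeight, addParticle, max_comm]
  omega

/-- The height of the highest particle decreases by one in each step unless a ball is thrown
higher, and by uniform integrability the mean excess of a throw over a high level `K` is at
most `1 / 2`. -/
theorem exists_drift {n : ℕ} {ν : Config n → PMF ℕ} (hnc : Noncolliding ν)
    (hui : UniformlyIntegrable ν) :
    ∃ K : ℕ, ∀ A, CountableChain.pull (transition ν)
        (fun A => 2 * ((maxHeight A - K : ℕ) : ℝ≥0∞)) A + 1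
      ≤ 2 * ((maxHeight A - K : ℕ) : ℝ≥0∞) + 2 * {A | maxHeight A ≤ K}.indicator 1 A := by
  obtain ⟨K, hK⟩ := exists_tsum_mul_sub_le hui
  refine ⟨K, fun A => ?_⟩
  have hstep : CountableChain.pull (transition ν) (fun A => 2 * ((maxHeight A - K : ℕ) : ℝ≥0∞)) A
      ≤ 2 * ((maxHeight A - 1 - K : ℕ) : ℝ≥0∞) + 1 := by
    by_cases hA : 0 ∈ A.1
    · rw [pull_transition_of_mem hnc hA]
      calc _ ≤ ∑' y, (ν (others A) y * (2 * ((maxHeight A - 1 - K : ℕ) : ℝ≥0∞))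
              + ν (others A) y * (2 * ((y - K : ℕ) : ℝ≥0∞))) := by
            refine ENNReal.tsum_le_tsum fun y => ?_
            rw [← mul_add, ← mul_add]
            gcongr
            split_ifs with hy
            · exact zero_le
            · gcongr
              have h1 := maxHeight_addParticle_sub_le (others A) hy K
              have h2 := maxHeight_others_le A
              exact_mod_cast h1.trans (by omega)
        _ ≤ _ := by
          rw [ENNReal.tsum_add, ENNReal.tsum_mul_right, PMF.tsum_coe, one_mul]
          exact add_le_add_right (hK _) _
    · rw [pull_transition_of_notMem ν hA]
      refine le_trans ?_ le_self_add
      gcongr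
      exact sup_shiftDown_le A.1
  refine (add_le_add_left hstep 1).trans ?_
  by_cases h : maxHeight A ≤ K
  · simp only [Set.indicator_of_mem (show A ∈ {A | maxHeight A ≤ K} from h), Pi.one_apply, mul_one]
    rw [show maxHeight A - 1 - K = 0 by omega]
    simp [one_add_one_eq_two]
  · simp only [Set.indicator_of_notMem (show A ∉ {A | maxHeight A ≤ K} from h), mul_zero, add_zero]
    rw [show maxHeight A - K = maxHeight A - 1 - K + 1 by omega]
    push_cast
    rw [mul_add, add_assoc, one_add_one_eq_two, mul_one]

/-! ### Laws of the process -/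

theorem stepTransition_eq_push_iterate {n : ℕ} (ν : Config n → PMF ℕ) (t : ℕ)
    (A : Config (n + 1)) :
    stepTransition ν t A = (CountableChain.push (transition ν))^[t] (Pi.single A 1) := by
  induction t with
  | zero =>
    ext B
    simp [stepTransition, Pi.single_apply, eq_comm]
  | succ t ih =>
    rw [Function.iterate_succ_apply', ← ih]
    rfl

theorem stepTransition_eq_pull_iterate {n : ℕ} (ν : Config n → PMF ℕ) (t : ℕ)
    (A B : Config (n + 1)) :
    stepTransition ν t A B = (CountableChain.pull (transition ν))^[t] (Pi.single B 1) A := by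
  rw [stepTransition_eq_push_iterate, CountableChain.push_iterate_apply, tsum_eq_single A]
  · simp
  · intro C hC
    simp [hC]

theorem stepTransition_succ_left {n : ℕ} (ν : Config n → PMF ℕ) (t : ℕ)
    (A B : Config (n + 1)) :
    stepTransition ν (t + 1) A B = ∑' C, transition ν A C * stepTransition ν t C B := by
  simp only [stepTransition_eq_pull_iterate, Function.iterate_succ_apply']
  rfl

/-- The Markov property for a finite initial piece of the trajectory and a later position; the
induction on `j` conditions on the first step after time `k`. -/
theorem IsJEP.measure_inter {n : ℕ} {ν : Config n → PMF ℕ} {Ω : Type*} [MeasurableSpace Ω]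
    {μ : MeasureTheory.Measure Ω} {X : ℕ → Ω → Config (n + 1)} (hX : IsJEP ν μ X) (j k : ℕ)
    (a : ℕ → Config (n + 1)) (B : Config (n + 1)) :
    μ ({ω | ∀ s ≤ k, X s ω = a s} ∩ {ω | X (k + j) ω = B}) =
      μ {ω | ∀ s ≤ k, X s ω = a s} * stepTransition ν j (a k) B := by
  induction j generalizing k a with
  | zero =>
    by_cases h : a k = B
    · simp only [stepTransition, h, if_true, mul_one]
      congr 1
      ext ω
      simp only [Set.mem_inter_iff, Set.mem_ofPred_eq, Nat.add_zero, and_iff_left_iff_imp]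
      exact fun hω => (hω k le_rfl).trans h
    · simp only [stepTransition, h, if_false, mul_zero]
      refine MeasureTheory.measure_mono_null ?_ MeasureTheory.measure_empty
      rintro ω ⟨h1, h2⟩
      exact h ((h1 k le_rfl).symm.trans h2)
  | succ j ih =>
    have hprefix : ∀ C : Config (n + 1),
        {ω | ∀ s ≤ k + 1, X s ω = Function.update a (k + 1) C s} =
          {ω | ∀ s ≤ k, X s ω = a s} ∩ {ω | X (k + 1) ω = C} := by
      intro C
      ext ω
      simp only [Set.mem_ofPred_eq, Set.mem_inter_iff]
      constructor
      · intro h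
        refine ⟨fun s hs => ?_, by simpa using h (k + 1) le_rfl⟩
        have := h s (by omega)
        rwa [Function.update_of_ne (by omega)] at this
      · rintro ⟨h1, h2⟩ s hs
        rcases Nat.lt_or_ge k s with h | h
        · obtain rfl : s = k + 1 := by omega
          simpa using h2
        · rw [Function.update_of_ne (by omega)]
          exact h1 s h
    have hmeas : ∀ t (a : ℕ → Config (n + 1)), MeasurableSet {ω | ∀ s ≤ t, X s ω = a s} := by
      intro t a
      simp only [Set.ofPred_forall]
      exact MeasurableSet.iInter fun s => MeasurableSet.iInter fun _ => hX.measurable s _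
    have hunion : {ω | ∀ s ≤ k, X s ω = a s} ∩ {ω | X (k + (j + 1)) ω = B} =
        ⋃ C, ({ω | ∀ s ≤ k + 1, X s ω = Function.update a (k + 1) C s} ∩
          {ω | X (k + 1 + j) ω = B}) := by
      ext ω
      simp only [hprefix, Set.mem_iUnion, Set.mem_inter_iff, Set.mem_ofPred_eq,
        show k + (j + 1) = k + 1 + j by ring]
      constructor
      · rintro ⟨h1, h2⟩
        exact ⟨_, ⟨h1, rfl⟩, h2⟩
      · rintro ⟨C, ⟨h1, -⟩, h2⟩
        exact ⟨h1, h2⟩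
    rw [hunion, MeasureTheory.measure_iUnion, stepTransition_succ_left, ← ENNReal.tsum_mul_left]
    · refine tsum_congr fun C => ?_
      have hpre : {ω | ∀ s ≤ k, X s ω = Function.update a (k + 1) C s} =
          {ω | ∀ s ≤ k, X s ω = a s} := by
        ext ω
        refine forall₂_congr fun s hs => ?_
        rw [Function.update_of_ne (by omega)]
      rw [ih (k + 1) (Function.update a (k + 1) C), hX.markov k, hpre, Function.update_self,
        Function.update_of_ne (by omega), mul_assoc]
    · intro C C' hCC'
      rw [Function.onFun, Set.disjoint_left]
      rintro ω ⟨h1, -⟩ ⟨h2, -⟩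
      have e1 := h1 (k + 1) le_rfl
      have e2 := h2 (k + 1) le_rfl
      rw [Function.update_self] at e1 e2
      exact hCC' (e1.symm.trans e2)
    · exact fun C => (hmeas _ _).inter (hX.measurable _ _)

theorem IsJEP.measure_eq_stepTransition {n : ℕ} {ν : Config n → PMF ℕ} {Ω : Type*}
    [MeasurableSpace Ω] {μ : MeasureTheory.Measure Ω} [MeasureTheory.IsProbabilityMeasure μ]
    {X : ℕ → Ω → Config (n + 1)} (hX : IsJEP ν μ X) {A : Config (n + 1)}
    (hA : ∀ᵐ ω ∂μ, X 0 ω = A) (t : ℕ) (B : Config (n + 1)) :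
    μ {ω | X t ω = B} = stepTransition ν t A B := by
  have h := hX.measure_inter t 0 (fun _ => A) B
  have hA' : ∀ᵐ ω ∂μ, ω ∈ {ω | ∀ s ≤ 0, X s ω = A} := by
    filter_upwards [hA] with ω hω s hs
    rw [Nat.le_zero.1 hs, hω]
  have huniv : ({ω | ∀ s ≤ 0, X s ω = A} : Set Ω) =ᵐ[μ] Set.univ :=
    MeasureTheory.ae_eq_univ.2 hA'
  rw [MeasureTheory.measure_congr (MeasureTheory.inter_ae_eq_right_of_ae_eq_univ huniv),
    MeasureTheory.measure_congr huniv, MeasureTheory.measure_univ, one_mul, Nat.zero_add] at h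
  exact h

/-! ### Total variation -/

theorem tvDist_le {S : Type*} {p q : S → ℝ≥0∞} (hp : ∑' x, p x = 1) (hq : ∑' x, q x = 1) :
    tvDist p q ≤ CountableChain.excess p q := by
  have key : ∀ (p q : S → ℝ≥0∞) (E : Set S),
      (∑' x : E, p x) - ∑' x : E, q x ≤ CountableChain.excess p q := by
    intro p q E
    rw [tsub_le_iff_right]
    calc _ ≤ ∑' x : E, ((p x - q x) + q x) := ENNReal.tsum_le_tsum fun x => le_tsub_add
      _ = (∑' x : E, (p x - q x)) + ∑' x : E, q x := ENNReal.tsum_add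
      _ ≤ _ := add_le_add_left
        (ENNReal.tsum_comp_le_tsum_of_injective Subtype.val_injective fun x => p x - q x) _
  refine iSup_le fun E => max_le (key p q E) ?_
  rw [CountableChain.excess_comm hp hq]
  exact key q p E

end Juggling

theorem theorem1 (n : ℕ) (ν : Juggling.Config n → PMF ℕ)
    (hnc : Juggling.Noncolliding ν)
    (hui : Juggling.UniformlyIntegrable ν)
    (hap : Juggling.AperiodicityCondition ν) :
    ∃ π : PMF (Juggling.Config (n + 1)),
      Juggling.IsEquilibrium ν π ∧
      (∀ π' : PMF (Juggling.Config (n + 1)), Juggling.IsEquilibrium ν π' → π' = π) ∧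
      (∀ A : Juggling.Config (n + 1),
        Filter.Tendsto (fun t : ℕ => Juggling.tvDist (Juggling.stepTransition ν t A) π)
          Filter.atTop (nhds 0)) ∧
      (∀ (Ω : Type*) [MeasurableSpace Ω] (μ : MeasureTheory.Measure Ω)
        [MeasureTheory.IsProbabilityMeasure μ] (X : ℕ → Ω → Juggling.Config (n + 1)),
        Juggling.IsJEP ν μ X →
        ∀ A : Juggling.Config (n + 1), (∀ᵐ ω ∂μ, X 0 ω = A) →
          Filter.Tendsto
            (fun t : ℕ => Juggling.tvDist (fun B => μ {ω | X t ω = B}) π)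
            Filter.atTop (nhds 0)) := by
  have hP := Juggling.tsum_transition hnc
  obtain ⟨K, hdrift⟩ := Juggling.exists_drift hnc hui
  obtain ⟨π, hπ, huniq, hlim⟩ := CountableChain.exists_unique_stationary_and_tendsto hP
    (Juggling.transition_ground_pos hap) (Juggling.exists_transition_pos_heightSum_lt hap)
    (Juggling.finite_setOf_maxHeight_le (n + 1) K)
    (fun A => ENNReal.mul_ne_top ENNReal.ofNat_ne_top (ENNReal.natCast_ne_top _))
    ENNReal.ofNat_ne_top hdrift
  have htv : ∀ A, Filter.Tendsto
      (fun t : ℕ => Juggling.tvDist (Juggling.stepTransition ν t A) π)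
      Filter.atTop (nhds 0) := by
    intro A
    refine tendsto_of_tendsto_of_tendsto_of_le_of_le tendsto_const_nhds (hlim A)
      (fun _ => zero_le) fun t => ?_
    rw [Juggling.stepTransition_eq_push_iterate]
    refine Juggling.tvDist_le ?_ π.tsum_coe
    rw [CountableChain.tsum_push_iterate hP, tsum_eq_single A (by intro z hz; simp [hz])]
    simp
  refine ⟨π, fun B => congrFun hπ B, fun π' hπ' => huniq π' (funext hπ'), htv, ?_⟩
  intro Ω _ μ _ X hX A hA
  simp only [hX.measure_eq_stepTransition hA]
  exact htv A
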